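/- Let $G$ be a connected undirected multigraph (loops and parallel edges allowed) embedded in the plane (up to homeomorphism of the sphere), with edge capacities $c(e)\ge 0$, and let $s\neq t$ be vertices of $G$. Let $G_D$ be its dual graph, embedded as usual: its vertices are the faces of $G$, and each edge $e$ of $G$ gives an edge $e_D$ of length $c(e)$ joining the faces on the two sides of $e$ and crossing only $e$. Let $\pi$ be a simple path in $G_D$ traversing the faces $f_1,\dots,f_k$ in this order, where $f_1$ is incident to $s$ and $f_k$ is incident to $t$. Fix a corner of $f_1$ at $s$ and a corner of $f_k$ at $t$, prolong $\pi$ through these corners to $s$ and $t$, and view the prolonged path as a horizontal line directed from $s$ to $t$; then every end, at some $f_i$, of an edge of $G_D$ not on $\pi$ is attached to $f_i$ either from above or from below. The graph $G_\pi'$ is obtained from $G_D$ by cutting along $\pi$: add new vertices $f_1',\dots,f_k'$ and a copy $\pi'$ of $\pi$ through them, whose edges have the lengths of the corresponding edges of $\pi$, and for each $i$ reconnect to $f_i'$ all edge ends attached to $f_i$ from above. Let $G_\pi''$ be a copy of $G_\pi'$. The graph $G_\pi$ is obtained from the disjoint union of $G_\pi'$ and $G_\pi''$ by identifying, for each $i$,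 the vertex $f_i'$ of $G_\pi''$ with the vertex $f_i$ of $G_\pi'$, and the vertex $f_i$ of $G_\pi''$ with the vertex $f_i'$ of $G_\pi'$. In $G_\pi$, the names $f_i,f_i'$ refer to the vertices of $G_\pi'$. A cut-cycle is a closed walk $C$ in $G_D$, not necessarily simple, that separates $s$ from $t$: there is a set $S$ of vertices of $G$ (the interior of $C$, by the even-odd rule) with $s\in S$ and $t\notin S$ such that an edge $e$ of $G$ has exactly one end in $S$ if and only if $C$ traverses $e_D$ an odd number of times. Its cost is the sum of the lengths of its edges, counted with multiplicity. An $f_i$-cut-cycle is a cut-cycle that visits $f_i$ and visits no $f_j$ with $j>i$. An $f_i$-separating path is a path (without repeated vertices) in $G_\pi$ from $f_i$ to $f_i'$ that contains neither $f_j$ nor $f_j'$ for any $j>i$. Then, for every $i\in\{1,\dots,k\}$, the cost of a minimum $f_i$-cut-cycle in $G_D$ equals the length of a shortest $f_i$-separating path in $G_\pi$. More precisely, either there is neither an $f_i$-cut-cycle nor an $f_i$-separating path, or both minima exist and they are equal. -/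

import Mathlib

/-- A weighted undirected multigraph (loops and parallel edges allowed) with vertex type `V`.
Every undirected edge is represented by its two darts (orientations) `a` and `rev a`; the dart `a`
leaves the vertex `src a`, and both darts of an edge carry the length of the edge. -/
structure WGraph (V A : Type*) where
  src : A → V
  rev : A → A
  rev_rev : ∀ a, rev (rev a) = a
  rev_ne : ∀ a, rev a ≠ a
  len : A → ℝ
  len_rev : ∀ a, len (rev a) = len a

namespace WGraph

variable {V A : Type*} (H : WGraph V A)

/-- The vertex at which a dart ends. -/
def dst (a : A) : V := H.src (H.rev a)

/-- The list of darts `l` is a walk from `u` to `v`. -/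
def IsWalk : V → List A → V → Prop
  | u, [], v => u = v
  | u, a :: l, v => H.src a = u ∧ IsWalk (H.dst a) l v

/-- The vertices visited, in order, by the walk that starts at `u` and has darts `l`. -/
def support (u : V) (l : List A) : List V := u :: l.map H.dst

/-- A path: a walk that repeats no vertex. -/
def IsPath (u : V) (l : List A) (v : V) : Prop :=
  H.IsWalk u l v ∧ (H.support u l).Nodup

/-- The length of a walk, edges counted with multiplicity. -/
def length (l : List A) : ℝ := (l.map H.len).sum

end WGraph

/-- A connected multigraph with at least one edge, embedded in the sphere (equivalently, in the
plane), given by its rotation system.  `D` is the set of darts, `α` reverses a dart, and `σ` sends a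
dart to the counterclockwise next dart leaving the same vertex.  Genus zero is Euler's formula. -/
structure PlanarMap (D : Type*) where
  σ : Equiv.Perm D
  α : Equiv.Perm D
  α_α : ∀ d, α (α d) = d
  α_ne : ∀ d, α d ≠ d
  connected : MulAction.IsPretransitive (Subgroup.closure {σ, α}) D
  euler :
    Nat.card (Quotient (Equiv.Perm.SameCycle.setoid σ)) +
      Nat.card (Quotient (Equiv.Perm.SameCycle.setoid (σ⁻¹ * α))) =
    Nat.card (Quotient (Equiv.Perm.SameCycle.setoid α)) + 2

namespace PlanarMap

variable {D : Type*} (G : PlanarMap D)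

/-- The face permutation: the next dart on the boundary of the face to the left of a dart.  It runs
counterclockwise around the face. -/
def φ : Equiv.Perm D := G.σ⁻¹ * G.α

/-- Vertices are the cycles of the rotation `σ`. -/
def Vertex : Type _ := Quotient (Equiv.Perm.SameCycle.setoid G.σ)

/-- Edges are the cycles of the reversal `α`. -/
def Edge : Type _ := Quotient (Equiv.Perm.SameCycle.setoid G.α)

/-- Faces are the cycles of `φ`. -/
def Face : Type _ := Quotient (Equiv.Perm.SameCycle.setoid G.φ)

/-- The vertex that a dart leaves. -/
def vertex (d : D) : G.Vertex := Quotient.mk (Equiv.Perm.SameCycle.setoid G.σ) d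

/-- The edge of a dart. -/
def edge (d : D) : G.Edge := Quotient.mk (Equiv.Perm.SameCycle.setoid G.α) d

/-- The face to the left of a dart. -/
def face (d : D) : G.Face := Quotient.mk (Equiv.Perm.SameCycle.setoid G.φ) d

theorem edge_α (d : D) : G.edge (G.α d) = G.edge d :=
  Quotient.sound (s := Equiv.Perm.SameCycle.setoid G.α)
    (Equiv.Perm.sameCycle_apply_left.2 (Equiv.Perm.SameCycle.refl _ _))

/-- The dual graph `G_D`: its vertices are the faces, and the edge of `d` becomes a dual edge of the
same weight that joins the faces on its two sides.  As a dual dart, `d` goes from the face on its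
left to the face on its right; the dual darts leaving a face are embedded around it in the
counterclockwise cyclic order `φ`. -/
def dual (c : G.Edge → ℝ) : WGraph G.Face D where
  src := G.face
  rev := G.α
  rev_rev := G.α_α
  rev_ne := G.α_ne
  len d := c (G.edge d)
  len_rev d := by rw [edge_α]

open Classical in
/-- `S` is the set of vertices of `G` in the interior (by the even-odd rule) of the closed walk `C`
of `G_D`, with one of the two sides of `C` chosen as its interior: the edges of `G` with exactly one
end in `S` are those that `C` crosses an odd number of times. -/
def IsInterior (C : List D) (S : Set G.Vertex) : Prop :=
  ∀ d : D, Xor (G.vertex d ∈ S) (G.vertex (G.α d) ∈ S) ↔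
    Odd ((C.map G.edge).count (G.edge d))

/-- `C` (starting from `u`) is a cut-cycle for `s` and `t`: a closed walk in `G_D` whose interior
contains `s` but not `t`. -/
def IsCutCycle (c : G.Edge → ℝ) (s t : G.Vertex) (u : G.Face) (C : List D) : Prop :=
  (G.dual c).IsWalk u C u ∧ ∃ S : Set G.Vertex, G.IsInterior C S ∧ s ∈ S ∧ t ∉ S

/-- A simple path `π` in `G_D` from a face `f 0` incident to `s` to a face `f n` incident to `t`
(so it visits `k = n + 1` faces, here numbered from `0`), with darts `p j` from `f j` to `f (j+1)`.
The incidences are witnessed by corners: a dart `d` stands for the corner that lies between `φ⁻¹ d`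
and `d` on the boundary of `face d`, and this corner is at `vertex d`. -/
structure DualPath (s t : G.Vertex) where
  n : ℕ
  f : Fin (n + 1) → G.Face
  f_injective : Function.Injective f
  p : Fin n → D
  face_p : ∀ j : Fin n, G.face (p j) = f j.castSucc
  face_α_p : ∀ j : Fin n, G.face (G.α (p j)) = f j.succ
  startCorner : D
  vertex_startCorner : G.vertex startCorner = s
  face_startCorner : G.face startCorner = f 0
  endCorner : D
  vertex_endCorner : G.vertex endCorner = t
  face_endCorner : G.face endCorner = f (Fin.last n)

namespace DualPath

variable {G} {s t : G.Vertex} (π : G.DualPath s t)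

/-- `π` leaves `f i` through its next edge or, at the last face, towards `t` through the corner
`endCorner`.  This is the first dual dart after that, counterclockwise around `f i`. -/
def upperStart (i : Fin (π.n + 1)) : D :=
  Fin.lastCases (motive := fun _ => D) π.endCorner (fun j => G.φ (π.p j)) i

/-- `π` enters `f i` through its previous edge or, at the first face, from `s` through the corner
`startCorner`.  This is the first dual dart from there on, counterclockwise around `f i`. -/
def upperStop (i : Fin (π.n + 1)) : D :=
  Fin.cases (motive := fun _ => D) π.startCorner (fun j => G.α (π.p j)) i

/-- With `π` (prolonged by `s` and `t`) drawn from left to right, the dual dart `d` is attached to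
`f i` from above: counterclockwise around `f i` it lies strictly between the place where `π` leaves
and the place where `π` enters.  All other dual darts at `f i` are on `π` or below it. -/
def IsAbove (i : Fin (π.n + 1)) (d : D) : Prop :=
  ∃ m : ℕ, (G.φ ^ m) (π.upperStart i) = d ∧ ∀ r ≤ m, (G.φ ^ r) (π.upperStart i) ≠ π.upperStop i

open Classical in
/-- The vertex of the cut graph to which the tail of the dual dart `d` is attached: the new vertex
`f i'` (written `Sum.inr i`) if `d` is attached to `f i` from above, and its old vertex otherwise. -/
noncomputable def attach (d : D) : G.Face ⊕ Fin (π.n + 1) :=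
  if h : ∃ i, π.IsAbove i d then Sum.inr h.choose else Sum.inl (G.face d)

/-- The graph `G_π'`: `G_D` cut along `π`.  Its vertices are the faces and the new vertices `f i'`.
Its edges are those of `G_D`, where the ends that enter some `f i` from above are reconnected to
`f i'`, and the edges of the copy `π'` of `π`; the two darts of the `j`-th edge of `π'` are
`Sum.inr (j, false)`, from `f j'` to `f (j+1)'`, and its reverse `Sum.inr (j, true)`. -/
noncomputable def cutGraph (c : G.Edge → ℝ) :
    WGraph (G.Face ⊕ Fin (π.n + 1)) (D ⊕ (Fin π.n × Bool)) where
  src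
    | Sum.inl d => π.attach d
    | Sum.inr (j, false) => Sum.inr j.castSucc
    | Sum.inr (j, true) => Sum.inr j.succ
  rev
    | Sum.inl d => Sum.inl (G.α d)
    | Sum.inr (j, b) => Sum.inr (j, !b)
  rev_rev := by rintro (d | ⟨j, b⟩) <;> simp [G.α_α]
  rev_ne := by rintro (d | ⟨j, b⟩) <;> simp [G.α_ne]
  len
    | Sum.inl d => c (G.edge d)
    | Sum.inr (j, _) => c (G.edge (π.p j))
  len_rev := by rintro (d | ⟨j, b⟩) <;> simp [G.edge_α]

/-- The identifications that build `G_π` from `G_π'` (copy `false`) and `G_π''` (copy `true`): the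
path `π'` of `G_π''` is glued to the path `π` of `G_π'`, and the path `π` of `G_π''` is glued to the
path `π'` of `G_π'`. -/
inductive Glue : (G.Face ⊕ Fin (π.n + 1)) × Bool → (G.Face ⊕ Fin (π.n + 1)) × Bool → Prop
  | prime (i : Fin (π.n + 1)) : Glue (Sum.inr i, true) (Sum.inl (π.f i), false)
  | plain (i : Fin (π.n + 1)) : Glue (Sum.inl (π.f i), true) (Sum.inr i, false)

/-- The vertices of `G_π`. -/
def GluedVertex : Type _ := Quot π.Glue

/-- The graph `G_π`: two copies of `G_π'` with vertices identified along `π` and `π'`. -/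
noncomputable def gluedGraph (c : G.Edge → ℝ) :
    WGraph π.GluedVertex ((D ⊕ (Fin π.n × Bool)) × Bool) where
  src a := Quot.mk π.Glue ((π.cutGraph c).src a.1, a.2)
  rev a := ((π.cutGraph c).rev a.1, a.2)
  rev_rev a := by simp [(π.cutGraph c).rev_rev]
  rev_ne a h := (π.cutGraph c).rev_ne a.1 (congrArg Prod.fst h)
  len a := (π.cutGraph c).len a.1
  len_rev a := (π.cutGraph c).len_rev a.1

/-- The vertex `f i` of `G_π`. -/
def vertexF (i : Fin (π.n + 1)) : π.GluedVertex := Quot.mk π.Glue (Sum.inl (π.f i), false)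

/-- The vertex `f i'` of `G_π`. -/
def vertexF' (i : Fin (π.n + 1)) : π.GluedVertex := Quot.mk π.Glue (Sum.inr i, false)

/-- An `f i`-cut-cycle: a cut-cycle that includes `f i` and no `f j` with `j > i`. -/
def IsCutCycleAt (c : G.Edge → ℝ) (i : Fin (π.n + 1)) (u : G.Face) (C : List D) : Prop :=
  G.IsCutCycle c s t u C ∧ π.f i ∈ (G.dual c).support u C ∧
    ∀ j, i < j → π.f j ∉ (G.dual c).support u C

/-- An `f i`-separating path: a path in `G_π` from `f i` to `f i'` that contains neither `f j` nor
`f j'` for any `j > i`. -/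
def IsSeparatingPath (c : G.Edge → ℝ) (i : Fin (π.n + 1))
    (ρ : List ((D ⊕ (Fin π.n × Bool)) × Bool)) : Prop :=
  (π.gluedGraph c).IsPath (π.vertexF i) ρ (π.vertexF' i) ∧
    ∀ j, i < j → π.vertexF j ∉ (π.gluedGraph c).support (π.vertexF i) ρ ∧
      π.vertexF' j ∉ (π.gluedGraph c).support (π.vertexF i) ρ

/-- The costs of all `f i`-cut-cycles in `G_D`. -/
def cutCycleCosts (c : G.Edge → ℝ) (i : Fin (π.n + 1)) : Set ℝ :=
  {x | ∃ u C, π.IsCutCycleAt c i u C ∧ (G.dual c).length C = x}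

/-- The lengths of all `f i`-separating paths in `G_π`. -/
def separatingPathLengths (c : G.Edge → ℝ) (i : Fin (π.n + 1)) : Set ℝ :=
  {x | ∃ ρ, π.IsSeparatingPath c i ρ ∧ (π.gluedGraph c).length ρ = x}

end DualPath

end PlanarMap

/-! The graph `G_π` is a double cover of the dual graph, up to extra parallel copies of the edges of
π: a vertex is a face together with one of two sheets (`sheet`, `proj`), where `f i` lies in sheet
`false` and `f i'` in sheet `true`. Passing along a dual dart changes the sheet by its `voltage`,
which counts modulo 2 how many of its two ends are attached to π from above. Walks lift and project
with the same length over the same faces (`exists_lift`, `isWalk_proj`).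

The core is `isCutCycle_iff`: a closed dual walk separates `s` from `t` exactly when its total
voltage is 1. Genus zero makes the crossing parities of a closed walk the coboundary of a vertex
function `x` (`exists_coboundary`, by ranks and Euler's formula). The darts attached from above,
read along the faces of π, form a walk in `G` from `t` to `s`; summing the coboundary along it gives
`x s + x t` (`sum_above_coboundary`), and counting the same crossings along the closed walk gives
its voltage (`sum_voltage`).

Hence a separating path projects to a cut-cycle of equal cost, and a cut-cycle rotated to start at
`f i` lifts to a walk from `f i` to `f i'`, which nonnegative lengths allow to be shortened to a
path. There are finitely many paths, so both minima exist together. -/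

namespace WGraph

/-! ### Walks and paths in weighted graphs -/

variable {V A : Type*} (H : WGraph V A)

theorem isWalk_append {u v : V} {l l' : List A} :
    H.IsWalk u (l ++ l') v ↔ ∃ w, H.IsWalk u l w ∧ H.IsWalk w l' v := by
  induction l generalizing u with
  | nil => simp [IsWalk]
  | cons a l ih => simp [IsWalk, ih, and_assoc]

theorem support_cons (u : V) (a : A) (l : List A) :
    H.support u (a :: l) = u :: H.support (H.dst a) l := rfl

theorem mem_support_self (u : V) (l : List A) : u ∈ H.support u l := by simp [support]

theorem IsWalk.target_mem_support {u v : V} {l : List A} (h : H.IsWalk u l v) :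
    v ∈ H.support u l := by
  induction l generalizing u with
  | nil => simp [IsWalk] at h; simp [support, h]
  | cons a l ih => exact List.mem_cons_of_mem _ (ih h.2)

theorem IsWalk.exists_append {u v w : V} {l : List A} (h : H.IsWalk u l v)
    (hw : w ∈ H.support u l) :
    ∃ l₁ l₂, l = l₁ ++ l₂ ∧ H.IsWalk u l₁ w ∧ H.IsWalk w l₂ v := by
  induction l generalizing u with
  | nil =>
    simp only [support, List.map_nil, List.mem_singleton] at hw
    subst hw
    exact ⟨[], [], rfl, rfl, h⟩
  | cons a l ih =>
    rw [support_cons, List.mem_cons] at hw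
    rcases hw with rfl | hw
    · exact ⟨[], a :: l, rfl, rfl, h⟩
    · obtain ⟨l₁, l₂, rfl, h₁, h₂⟩ := ih h.2 hw
      exact ⟨a :: l₁, l₂, rfl, ⟨h.1, h₁⟩, h₂⟩

theorem support_append (u w : V) (l l' : List A) :
    H.support u (l ++ l') = H.support u l ++ (H.support w l').tail := by
  simp [support]

theorem support_subset_of_isWalk_append {u w : V} {l l' : List A} (h : H.IsWalk u l w) :
    H.support w l' ⊆ H.support u (l ++ l') := by
  intro x hx
  rw [support_append H u w]
  rcases List.mem_cons.1 hx with rfl | hx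
  · exact List.mem_append_left _ (IsWalk.target_mem_support H h)
  · exact List.mem_append_right _ hx

theorem IsWalk.support_nodup_of_append {u w : V} {l l' : List A} (h : H.IsWalk u l w)
    (hn : (H.support u (l ++ l')).Nodup) : (H.support w l').Nodup := by
  induction l generalizing u with
  | nil => obtain rfl : u = w := h; exact hn
  | cons a l ih => exact ih h.2 (List.nodup_cons.1 hn).2

theorem length_append (l l' : List A) : H.length (l ++ l') = H.length l + H.length l' := by
  simp [length]

theorem length_nonneg (h : ∀ a, 0 ≤ H.len a) (l : List A) : 0 ≤ H.length l :=
  List.sum_nonneg (by simpa using fun a _ => h a)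

/-- A walk can be shortened to a path. -/
theorem IsWalk.exists_isPath (hlen : ∀ a, 0 ≤ H.len a) {u v : V} {l : List A}
    (h : H.IsWalk u l v) :
    ∃ l', H.IsPath u l' v ∧ H.support u l' ⊆ H.support u l ∧ H.length l' ≤ H.length l := by
  induction l generalizing u with
  | nil => exact ⟨[], ⟨h, by simp [support]⟩, List.Subset.refl _, le_rfl⟩
  | cons a l ih =>
    obtain ⟨l', hp, hs, hl⟩ := ih h.2
    have hcons : H.length (a :: l) = H.len a + H.length l := by simp [length]
    -- If the start recurs on the shortened tail, the loop back to it is dropped; this cannot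
    -- increase the length because edges have nonnegative length.
    by_cases hu : u ∈ H.support (H.dst a) l'
    · obtain ⟨l₁, l₂, rfl, h₁, h₂⟩ := IsWalk.exists_append H hp.1 hu
      refine ⟨l₂, ⟨h₂, IsWalk.support_nodup_of_append H h₁ hp.2⟩, ?_, ?_⟩
      · exact fun x hx => List.mem_cons_of_mem _ (hs (support_subset_of_isWalk_append H h₁ hx))
      · rw [length_append] at hl
        linarith [hlen a, length_nonneg H hlen l₁]
    · refine ⟨a :: l', ⟨⟨h.1, hp.1⟩, List.nodup_cons.2 ⟨hu, hp.2⟩⟩, ?_, ?_⟩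
      · exact List.cons_subset_cons _ hs
      · have : H.length (a :: l') = H.len a + H.length l' := by simp [length]
        linarith

theorem finite_setOf_support_nodup [Finite V] [Finite A] (u : V) :
    {l : List A | (H.support u l).Nodup}.Finite := by
  have := Fintype.ofFinite V
  refine (List.finite_length_le A (Fintype.card V)).subset fun l hl => ?_
  have := List.Nodup.length_le_card (show (H.support u l).Nodup from hl)
  simp [support] at this
  show l.length ≤ _
  omega

end WGraph

namespace PlanarMap

/-! ### Incidences and connectedness of the map -/

variable {D : Type*} (G : PlanarMap D)

theorem vertex_φ (d : D) : G.vertex (G.φ d) = G.vertex (G.α d) :=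
  Quotient.sound (s := Equiv.Perm.SameCycle.setoid G.σ)
    (Equiv.Perm.sameCycle_apply_left.1 (by simpa [φ] using Equiv.Perm.SameCycle.refl _ _))

theorem vertex_σ (d : D) : G.vertex (G.σ d) = G.vertex d :=
  Quotient.sound (s := Equiv.Perm.SameCycle.setoid G.σ)
    (Equiv.Perm.sameCycle_apply_left.2 (Equiv.Perm.SameCycle.refl _ _))

theorem face_φ (d : D) : G.face (G.φ d) = G.face d :=
  Quotient.sound (s := Equiv.Perm.SameCycle.setoid G.φ)
    (Equiv.Perm.sameCycle_apply_left.2 (Equiv.Perm.SameCycle.refl _ _))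

theorem face_φ_pow (m : ℕ) (d : D) : G.face ((G.φ ^ m) d) = G.face d := by
  induction m with
  | zero => rfl
  | succ m ih => rw [pow_succ', Equiv.Perm.mul_apply, face_φ, ih]

theorem vertex_surjective : Function.Surjective G.vertex := Quotient.mk_surjective

theorem face_surjective : Function.Surjective G.face := Quotient.mk_surjective

theorem edge_surjective : Function.Surjective G.edge := Quotient.mk_surjective

theorem edge_eq_iff {a d : D} : G.edge a = G.edge d ↔ a = d ∨ a = G.α d := by
  constructor
  · intro h
    obtain ⟨n, hn⟩ : G.α.SameCycle d a := Quotient.exact (s := Equiv.Perm.SameCycle.setoid G.α) h.symm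
    have h2 : G.α * G.α = 1 := Equiv.ext G.α_α
    rcases Int.even_or_odd' n with ⟨k, rfl | rfl⟩
    · left; rw [zpow_mul, zpow_two, h2, one_zpow] at hn; exact hn.symm
    · right; rw [zpow_add, zpow_mul, zpow_two, h2, one_zpow, one_mul, zpow_one] at hn; exact hn.symm
  · rintro (rfl | rfl)
    · rfl
    · exact G.edge_α d

/-- A function on darts that is invariant under `σ` and `α` is constant. -/
theorem eq_of_invariant {β : Type*} (y : D → β) (hσ : ∀ d, y (G.σ d) = y d)
    (hα : ∀ d, y (G.α d) = y d) (a b : D) : y a = y b := by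
  have key : ∀ g ∈ Subgroup.closure {G.σ, G.α}, ∀ d, y (g d) = y d := by
    intro g hg
    induction hg using Subgroup.closure_induction with
    | mem g hg =>
      rcases hg with rfl | rfl
      exacts [hσ, hα]
    | one => exact fun _ => rfl
    | mul g h _ _ ihg ihh => intro d; rw [Equiv.Perm.mul_apply, ihg, ihh]
    | inv g _ ih => intro d; rw [← ih, Equiv.Perm.coe_inv, Equiv.apply_symm_apply]
  obtain ⟨⟨g, hg⟩, rfl⟩ := G.connected.exists_smul_eq a b
  exact (key g hg a).symm

/-! ### Homology modulo 2 in genus zero -/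

section Homology

variable [Fintype D]

open Classical in
/-- The incidence matrix of the edges with the classes of darts under `q`, over `ZMod 2`. -/
noncomputable def incidence {X : Type*} (q : D → X) : Matrix G.Edge X (ZMod 2) :=
  Matrix.of fun e x => ∑ d, if G.edge d = e ∧ q d = x then 1 else 0

theorem sum_edge_eq [DecidableEq G.Edge] (a : D) (g : D → ZMod 2) :
    (∑ d, if G.edge d = G.edge a then g d else 0) = g a + g (G.α a) := by
  classical
  have : (Finset.univ.filter fun d => G.edge d = G.edge a) = {a, G.α a} := by
    ext d; simp [edge_eq_iff]
  rw [← Finset.sum_filter, this, Finset.sum_pair (G.α_ne a).symm]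

/-- When both darts of an edge lie in the same class, the entry is `1 + 1 = 0`, so loops need no
separate treatment. -/
theorem incidence_mulVec {X : Type*} [Fintype X] (q : D → X) (x : X → ZMod 2) (a : D) :
    (G.incidence q).mulVec x (G.edge a) = x (q a) + x (q (G.α a)) := by
  classical
  rw [← G.sum_edge_eq a fun d => x (q d)]
  simp only [Matrix.mulVec, dotProduct, incidence, Matrix.of_apply, Finset.sum_mul]
  rw [Finset.sum_comm]
  refine Finset.sum_congr rfl fun d _ => ?_
  by_cases h : G.edge d = G.edge a <;> simp [h]

theorem incidence_transpose_mulVec {X : Type*} [DecidableEq X] [Fintype G.Edge] (q : D → X)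
    (y : G.Edge → ZMod 2) (x : X) :
    (G.incidence q).transpose.mulVec y x = ∑ d, if q d = x then y (G.edge d) else 0 := by
  classical
  simp only [Matrix.mulVec, dotProduct, incidence, Matrix.transpose_apply, Matrix.of_apply,
    Finset.sum_mul]
  rw [Finset.sum_comm]
  refine Finset.sum_congr rfl fun d _ => ?_
  by_cases h : q d = x <;> simp [h]

/-- A kernel vector is constant across each edge, hence under `hinv` constant everywhere by
connectedness. The kernel has dimension at most one, and rank-nullity gives the bound. It serves for
both vertices and faces. -/
theorem card_le_rank_incidence {X : Type*} [Fintype X] [Fintype G.Edge] (q : D → X)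
    (hq : Function.Surjective q)
    (hinv : ∀ x : X → ZMod 2, (∀ d, x (q (G.α d)) = x (q d)) → ∀ d, x (q (G.σ d)) = x (q d)) :
    Fintype.card X ≤ (G.incidence q).rank + 1 := by
  have h := (G.incidence q).mulVecLin.finrank_range_add_finrank_ker
  have hk : Module.finrank (ZMod 2) (LinearMap.ker (G.incidence q).mulVecLin) ≤ 1 := by
    have hle : LinearMap.ker (G.incidence q).mulVecLin ≤ Submodule.span (ZMod 2) {1} := by
      intro x hx
      have hα : ∀ d, x (q (G.α d)) = x (q d) := by
        intro d
        have := congrFun (LinearMap.mem_ker.1 hx) (G.edge d)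
        rw [Matrix.mulVecLin_apply, incidence_mulVec, Pi.zero_apply] at this
        exact (CharTwo.add_eq_zero.1 this).symm
      have hc := G.eq_of_invariant (fun d => x (q d)) (hinv x hα) hα
      rw [Submodule.mem_span_singleton]
      rcases isEmpty_or_nonempty D with hD | ⟨⟨d⟩⟩
      · exact ⟨0, funext fun v => (hD.false (hq v).choose).elim⟩
      · refine ⟨x (q d), funext fun v => ?_⟩
        obtain ⟨a, rfl⟩ := hq v
        simpa using hc d a
    exact (Submodule.finrank_mono hle).trans
      ((finrank_span_le_card _).trans (by simp))
  rw [Module.finrank_fintype_fun_eq_card] at h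
  rw [Matrix.rank]
  omega

/-- In genus zero every cycle of the dual graph, modulo 2, is a coboundary. -/
theorem exists_coboundary (y : G.Edge → ZMod 2)
    (hy : ∀ z : G.Face → ZMod 2, ∑ d, z (G.face d) * y (G.edge d) = 0) :
    ∃ x : G.Vertex → ZMod 2, ∀ d, x (G.vertex d) + x (G.vertex (G.α d)) = y (G.edge d) := by
  classical
  have : Finite G.Vertex := Finite.of_surjective _ G.vertex_surjective
  have : Finite G.Face := Finite.of_surjective _ G.face_surjective
  have : Finite G.Edge := Finite.of_surjective _ G.edge_surjective
  have := Fintype.ofFinite G.Vertex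
  have := Fintype.ofFinite G.Face
  have := Fintype.ofFinite G.Edge
  have hE : Fintype.card G.Vertex + Fintype.card G.Face = Fintype.card G.Edge + 2 := by
    simp only [← Nat.card_eq_fintype_card]
    exact G.euler
  have hV := G.card_le_rank_incidence G.vertex G.vertex_surjective fun x _ d => by
    rw [vertex_σ]
  have hF := G.card_le_rank_incidence G.face G.face_surjective fun x hx d => by
    have h1 := G.face_φ (G.α (G.σ d))
    have h2 : G.φ (G.α (G.σ d)) = d := by simp [φ, G.α_α]
    rw [h2] at h1
    rw [h1, hx]
  have hle : LinearMap.range (G.incidence G.vertex).mulVecLin ≤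
      LinearMap.ker (G.incidence G.face).transpose.mulVecLin := by
    rintro _ ⟨x, rfl⟩
    rw [LinearMap.mem_ker]
    funext f
    rw [Matrix.mulVecLin_apply, Matrix.mulVecLin_apply, incidence_transpose_mulVec]
    simp only [incidence_mulVec, ← vertex_φ]
    -- The boundary of a face is closed: shifting by `φ` within the face shows that each vertex
    -- value occurs an even number of times.
    have hre := Equiv.sum_comp G.φ fun d => if G.face d = f then x (G.vertex d) else 0
    simp only [face_φ] at hre
    have hsplit : ∀ d, (if G.face d = f then x (G.vertex d) + x (G.vertex (G.φ d)) else 0) =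
        (if G.face d = f then x (G.vertex d) else 0) +
          (if G.face d = f then x (G.vertex (G.φ d)) else 0) := by
      intro d; split_ifs <;> simp
    rw [Finset.sum_congr rfl fun d _ => hsplit d, Finset.sum_add_distrib, hre,
      CharTwo.add_self_eq_zero, Pi.zero_apply]
  have hk := (G.incidence G.face).transpose.mulVecLin.finrank_range_add_finrank_ker
  have ht := (G.incidence G.face).rank_transpose
  rw [Module.finrank_fintype_fun_eq_card] at hk
  rw [Matrix.rank] at ht hV
  -- The range has dimension at least `V - 1`, the kernel at most `E - (F - 1)`, and Euler's formula
  -- makes these two bounds equal.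
  have heq := Submodule.eq_of_le_of_finrank_le hle (by omega)
  have hmem : y ∈ LinearMap.ker (G.incidence G.face).transpose.mulVecLin := by
    rw [LinearMap.mem_ker]
    funext f
    rw [Matrix.mulVecLin_apply, incidence_transpose_mulVec]
    simpa using hy fun f' => if f' = f then 1 else 0
  rw [← heq] at hmem
  obtain ⟨x, rfl⟩ := hmem
  exact ⟨x, fun d => (G.incidence_mulVec _ _ _).symm⟩

/-- Double counting: each dart `a` of `C` is matched by exactly the two darts `a` and `α a` of its
edge. -/
theorem sum_mul_count [DecidableEq G.Edge] (g : D → ZMod 2) (C : List D) :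
    ∑ d, g d * ((C.map G.edge).count (G.edge d) : ZMod 2) =
      (C.map fun a => g a + g (G.α a)).sum := by
  induction C with
  | nil => simp
  | cons a C ih =>
    simp only [List.map_cons, List.count_cons, Nat.cast_add, mul_add, Finset.sum_add_distrib, ih,
      List.sum_cons]
    rw [add_comm, ← G.sum_edge_eq a g]
    congr 1
    refine Finset.sum_congr rfl fun d _ => ?_
    by_cases h : G.edge d = G.edge a
    · simp [h]
    · simp [h, Ne.symm h]

end Homology

/-! ### Closed dual walks and their interiors -/

theorem sum_of_isWalk_dual (c : G.Edge → ℝ) (z : G.Face → ZMod 2) {u v : G.Face} {C : List D}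
    (h : (G.dual c).IsWalk u C v) :
    (C.map fun a => z (G.face a) + z (G.face (G.α a))).sum = z u + z v := by
  induction C generalizing u with
  | nil =>
    obtain rfl : u = v := h
    simp [CharTwo.add_self_eq_zero]
  | cons a C ih =>
    obtain ⟨rfl, h⟩ := h
    rw [List.map_cons, List.sum_cons, ih h]
    change z (G.face a) + z (G.face (G.α a)) + (z (G.face (G.α a)) + z v) = z (G.face a) + z v
    linear_combination CharTwo.add_self_eq_zero (z (G.face (G.α a)))

open Classical in
theorem isInterior_iff (C : List D) (x : G.Vertex → ZMod 2) :
    G.IsInterior C {v | x v = 1} ↔ ∀ d, x (G.vertex d) + x (G.vertex (G.α d)) =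
      ((C.map G.edge).count (G.edge d) : ZMod 2) := by
  refine forall_congr' fun d => ?_
  rw [← ZMod.natCast_eq_one_iff_odd]
  generalize (((C.map G.edge).count (G.edge d) : ℕ) : ZMod 2) = k
  simp only [Set.mem_ofPred_eq]
  generalize x (G.vertex d) = p
  generalize x (G.vertex (G.α d)) = q
  revert p q k
  unfold Xor
  decide

end PlanarMap

/-! ### The double cover of the dual graph and its voltages -/

namespace PlanarMap

namespace DualPath

variable {D : Type*} {G : PlanarMap D} {s t : G.Vertex} (π : G.DualPath s t)

theorem upperStart_last : π.upperStart (Fin.last π.n) = π.endCorner := by simp [upperStart]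

theorem upperStart_castSucc (j : Fin π.n) : π.upperStart j.castSucc = G.φ (π.p j) := by
  simp [upperStart]

theorem upperStop_zero : π.upperStop 0 = π.startCorner := rfl

theorem upperStop_succ (j : Fin π.n) : π.upperStop j.succ = G.α (π.p j) := rfl

theorem face_upperStart (i : Fin (π.n + 1)) : G.face (π.upperStart i) = π.f i := by
  induction i using Fin.lastCases with
  | last => rw [upperStart_last, face_endCorner]
  | cast j => rw [upperStart_castSucc, face_φ, face_p]

theorem face_upperStop (i : Fin (π.n + 1)) : G.face (π.upperStop i) = π.f i := by
  induction i using Fin.cases with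
  | zero => rw [upperStop_zero, face_startCorner]
  | succ j => rw [upperStop_succ, face_α_p]

variable {π} in
theorem IsAbove.face_eq {i : Fin (π.n + 1)} {d : D} (h : π.IsAbove i d) : G.face d = π.f i := by
  obtain ⟨m, rfl, -⟩ := h
  rw [face_φ_pow, face_upperStart]

variable {π} in
theorem IsAbove.unique {i j : Fin (π.n + 1)} {d : D} (h : π.IsAbove i d) (h' : π.IsAbove j d) :
    i = j :=
  π.f_injective (h.face_eq.symm.trans h'.face_eq)

open Classical in
/-- Whether the tail of a dual dart is attached to the path from above. -/
noncomputable def above (d : D) : Bool := decide (∃ i, π.IsAbove i d)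

/-- The vertices of `G_π` are the faces of `G` in two sheets. -/
def sheet (f : G.Face) (b : Bool) : π.GluedVertex := Quot.mk π.Glue (Sum.inl f, b)

/-- The face and the sheet of a vertex of `G_π`. -/
def proj : π.GluedVertex → G.Face × Bool :=
  Quot.lift (fun v => match v with
    | (Sum.inl f, b) => (f, b)
    | (Sum.inr i, b) => (π.f i, !b)) (by rintro _ _ (i | i) <;> rfl)

theorem proj_sheet (f : G.Face) (b : Bool) : π.proj (π.sheet f b) = (f, b) := rfl

theorem mk_inr (i : Fin (π.n + 1)) (b : Bool) :
    (Quot.mk π.Glue (Sum.inr i, b) : π.GluedVertex) = π.sheet (π.f i) (!b) := by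
  cases b
  · exact (Quot.sound (Glue.plain i)).symm
  · exact Quot.sound (Glue.prime i)

theorem sheet_proj (v : π.GluedVertex) : π.sheet (π.proj v).1 (π.proj v).2 = v := by
  induction v using Quot.ind with
  | mk v =>
    obtain ⟨f | i, b⟩ := v
    · rfl
    · exact (π.mk_inr i b).symm

theorem vertexF'_eq (i : Fin (π.n + 1)) : π.vertexF' i = π.sheet (π.f i) true := π.mk_inr i false

theorem src_inl (c : G.Edge → ℝ) (d : D) (b : Bool) :
    (π.gluedGraph c).src (Sum.inl d, b) = π.sheet (G.face d) (b ^^ π.above d) := by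
  change Quot.mk π.Glue (π.attach d, b) = _
  unfold attach
  split_ifs with h
  · have hd : π.above d = true := by simpa [above] using h
    rw [mk_inr, h.choose_spec.face_eq, hd, Bool.xor_true]
  · have hd : π.above d = false := by simpa [above] using h
    rw [hd, Bool.xor_false, sheet]

theorem dst_inl (c : G.Edge → ℝ) (d : D) (b : Bool) :
    (π.gluedGraph c).dst (Sum.inl d, b) = π.sheet (G.face (G.α d)) (b ^^ π.above (G.α d)) :=
  π.src_inl c (G.α d) b

/-- The class modulo 2 of a sheet. -/
def bit (b : Bool) : ZMod 2 := if b then 1 else 0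

theorem bit_injective : Function.Injective bit := by unfold bit; decide

theorem bit_xor (a b : Bool) : bit (a ^^ b) = bit a + bit b := by revert a b; unfold bit; decide

/-- The change of sheets along a dual dart. -/
noncomputable def voltage (d : D) : ZMod 2 := bit (π.above d) + bit (π.above (G.α d))

theorem exists_lift (c : G.Edge → ℝ) {u v : G.Face} {C : List D}
    (h : (G.dual c).IsWalk u C v) (b : Bool) :
    ∃ ρ b', (π.gluedGraph c).IsWalk (π.sheet u b) ρ (π.sheet v b') ∧
      bit b' = bit b + (C.map π.voltage).sum ∧
      (π.gluedGraph c).length ρ = (G.dual c).length C ∧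
      ∀ w ∈ (π.gluedGraph c).support (π.sheet u b) ρ,
        (π.proj w).1 ∈ (G.dual c).support u C := by
  induction C generalizing u b with
  | nil =>
    obtain rfl : u = v := h
    exact ⟨[], b, rfl, by simp, by simp [WGraph.length], by simp [WGraph.support, proj_sheet]⟩
  | cons a C ih =>
    obtain ⟨rfl, h⟩ := h
    have hdst := π.dst_inl c a (b ^^ π.above a)
    obtain ⟨ρ, b', hw, hb, hl, hs⟩ := ih h ((b ^^ π.above a) ^^ π.above (G.α a))
    -- The tail of `a` in copy `b'` lies in sheet `b' ^^ π.above a`, so the copy to use from sheet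
    -- `b` is `b ^^ π.above a`.
    refine ⟨(Sum.inl a, b ^^ π.above a) :: ρ, b', ⟨?_, ?_⟩, ?_, ?_, ?_⟩
    · rw [src_inl, Bool.xor_assoc, Bool.xor_self, Bool.xor_false]
      rfl
    · rw [hdst]; exact hw
    · rw [hb, bit_xor, bit_xor, List.map_cons, List.sum_cons, voltage]; ring
    · simp only [WGraph.length, List.map_cons, List.sum_cons] at hl ⊢
      rw [hl]
      rfl
    · intro w hw
      rw [WGraph.support_cons, hdst, List.mem_cons] at hw
      rw [WGraph.support_cons]
      rcases hw with rfl | hw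
      · exact List.mem_cons_self
      · exact List.mem_cons_of_mem _ (hs w hw)

/-- The dual dart below a dart of `G_π`. -/
def projDart : (D ⊕ (Fin π.n × Bool)) × Bool → D
  | (Sum.inl d, _) => d
  | (Sum.inr (j, false), _) => π.p j
  | (Sum.inr (j, true), _) => G.α (π.p j)

theorem len_projDart (c : G.Edge → ℝ) (a : (D ⊕ (Fin π.n × Bool)) × Bool) :
    (G.dual c).len (π.projDart a) = (π.gluedGraph c).len a := by
  obtain ⟨d | ⟨j, _ | _⟩, b⟩ := a
  · rfl
  · rfl
  · exact congrArg c (G.edge_α _)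

theorem proj_src (c : G.Edge → ℝ) (a : (D ⊕ (Fin π.n × Bool)) × Bool) :
    (π.proj ((π.gluedGraph c).src a)).1 = G.face (π.projDart a) := by
  obtain ⟨d | ⟨j, _ | _⟩, b⟩ := a
  · rw [src_inl]; rfl
  · exact (π.face_p j).symm
  · exact (π.face_α_p j).symm

theorem proj_dst (c : G.Edge → ℝ) (a : (D ⊕ (Fin π.n × Bool)) × Bool) :
    (π.proj ((π.gluedGraph c).dst a)).1 = G.face (G.α (π.projDart a)) := by
  obtain ⟨d | ⟨j, _ | _⟩, b⟩ := a
  · rw [dst_inl]; rfl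
  · exact (π.face_α_p j).symm
  · rw [projDart, G.α_α]; exact (π.face_p j).symm

theorem support_proj (c : G.Edge → ℝ) (v : π.GluedVertex)
    (ρ : List ((D ⊕ (Fin π.n × Bool)) × Bool)) :
    (G.dual c).support (π.proj v).1 (ρ.map π.projDart) =
      ((π.gluedGraph c).support v ρ).map fun w => (π.proj w).1 := by
  simp only [WGraph.support, List.map_cons, List.map_map, List.cons.injEq, true_and]
  refine List.map_congr_left fun a _ => ?_
  exact (π.proj_dst c a).symm

theorem length_proj (c : G.Edge → ℝ) (ρ : List ((D ⊕ (Fin π.n × Bool)) × Bool)) :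
    (G.dual c).length (ρ.map π.projDart) = (π.gluedGraph c).length ρ := by
  simp only [WGraph.length, List.map_map]
  congr 1
  exact List.map_congr_left fun a _ => π.len_projDart c a

theorem above_α_p (j : Fin π.n) : π.above (G.α (π.p j)) = false := by
  simp only [above, decide_eq_false_iff_not]
  rintro ⟨i, h⟩
  obtain rfl : i = j.succ := π.f_injective (h.face_eq.symm.trans (π.face_α_p j))
  obtain ⟨m, hm, hr⟩ := h
  exact hr m le_rfl hm

variable [Finite D]

theorem exists_pow_upperStart (i : Fin (π.n + 1)) :
    ∃ m : ℕ, (G.φ ^ m) (π.upperStart i) = π.upperStop i := by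
  have h : G.φ.SameCycle (π.upperStart i) (π.upperStop i) :=
    Quotient.exact (s := Equiv.Perm.SameCycle.setoid G.φ)
      ((π.face_upperStart i).trans (π.face_upperStop i).symm)
  obtain ⟨m, -, hm⟩ := h.exists_pow_eq'
  exact ⟨m, hm⟩

/-- The upper arc starts just after `p j`. Reaching `p j` without meeting `upperStop` would mean
running through the whole `φ`-cycle, which contains `upperStop`. -/
theorem above_p (j : Fin π.n) : π.above (π.p j) = false := by
  simp only [above, decide_eq_false_iff_not]
  rintro ⟨i, h⟩
  obtain rfl : i = j.castSucc := π.f_injective (h.face_eq.symm.trans (π.face_p j))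
  obtain ⟨m, hm, hr⟩ := h
  obtain ⟨k, hk⟩ := π.exists_pow_upperStart j.castSucc
  have hper : (G.φ ^ (m + 1)) (π.upperStart j.castSucc) = π.upperStart j.castSucc := by
    rw [pow_succ', Equiv.Perm.mul_apply, hm, upperStart_castSucc]
  refine hr (k % (m + 1)) (Nat.lt_succ_iff.1 (Nat.mod_lt _ m.succ_pos)) ?_
  rw [← hk]
  conv_rhs => rw [← Nat.mod_add_div k (m + 1), pow_add, Equiv.Perm.mul_apply, pow_mul]
  rw [Equiv.Perm.pow_apply_eq_self_of_apply_eq_self hper]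

/-- The copied path edges stay within a sheet. This agrees with the voltage of their projections,
since neither dart of an edge of π is attached from above. -/
theorem bit_proj_dst (c : G.Edge → ℝ) (a : (D ⊕ (Fin π.n × Bool)) × Bool) :
    bit (π.proj ((π.gluedGraph c).dst a)).2 =
      bit (π.proj ((π.gluedGraph c).src a)).2 + π.voltage (π.projDart a) := by
  obtain ⟨d | ⟨j, _ | _⟩, b⟩ := a
  · rw [src_inl, dst_inl, proj_sheet, proj_sheet, bit_xor, bit_xor, voltage, projDart]
    linear_combination -CharTwo.add_self_eq_zero (bit (π.above d))
  · rw [voltage, projDart, above_p, above_α_p]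
    exact (add_zero _).symm
  · rw [voltage, projDart, G.α_α, above_p, above_α_p]
    exact (add_zero _).symm

theorem isWalk_proj (c : G.Edge → ℝ) {v w : π.GluedVertex}
    {ρ : List ((D ⊕ (Fin π.n × Bool)) × Bool)} (h : (π.gluedGraph c).IsWalk v ρ w) :
    (G.dual c).IsWalk (π.proj v).1 (ρ.map π.projDart) (π.proj w).1 ∧
      bit (π.proj w).2 = bit (π.proj v).2 + ((ρ.map π.projDart).map π.voltage).sum := by
  induction ρ generalizing v with
  | nil =>
    obtain rfl : v = w := h
    exact ⟨rfl, by simp⟩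
  | cons a ρ ih =>
    obtain ⟨rfl, h⟩ := h
    obtain ⟨hw, hb⟩ := ih h
    refine ⟨⟨(π.proj_src c a).symm, ?_⟩, ?_⟩
    · rw [proj_dst] at hw; exact hw
    · rw [hb, bit_proj_dst, List.map_cons, List.map_cons, List.sum_cons, add_assoc]

theorem finite_gluedVertex : Finite π.GluedVertex := by
  have : Finite G.Face := Finite.of_surjective _ G.face_surjective
  exact Finite.of_injective π.proj fun v w h => by
    rw [← π.sheet_proj v, ← π.sheet_proj w, h]

/-! ### The upper side of π as a walk, and the voltage criterion -/

open Classical in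
/-- The number of dual darts attached to a vertex of the path from above. -/
noncomputable def upperCount (i : Fin (π.n + 1)) : ℕ := Nat.find (π.exists_pow_upperStart i)

theorem pow_upperCount (i : Fin (π.n + 1)) :
    (G.φ ^ π.upperCount i) (π.upperStart i) = π.upperStop i := by
  classical exact Nat.find_spec (π.exists_pow_upperStart i)

theorem isAbove_iff (i : Fin (π.n + 1)) (d : D) :
    π.IsAbove i d ↔ ∃ m < π.upperCount i, (G.φ ^ m) (π.upperStart i) = d := by
  classical
  constructor
  · rintro ⟨m, hm, hr⟩
    refine ⟨m, ?_, hm⟩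
    by_contra! hle
    exact hr _ hle (π.pow_upperCount i)
  · rintro ⟨m, hlt, hm⟩
    exact ⟨m, hm, fun r hr => Nat.find_min (π.exists_pow_upperStart i) (hr.trans_lt hlt)⟩

/-- A repetition before the stop could be excised, reaching the stop in fewer than the minimal
number of steps. -/
theorem pow_upperStart_injOn (i : Fin (π.n + 1)) :
    Set.InjOn (fun m : ℕ => (G.φ ^ m) (π.upperStart i)) (Set.Iio (π.upperCount i)) := by
  classical
  have key : ∀ a b, a < b → b < π.upperCount i →
      (G.φ ^ a) (π.upperStart i) ≠ (G.φ ^ b) (π.upperStart i) := by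
    intro a b hab hb h
    refine Nat.find_min (π.exists_pow_upperStart i) (m := π.upperCount i - b + a)
      (show _ < π.upperCount i by omega) ?_
    rw [pow_add, Equiv.Perm.mul_apply, h, ← Equiv.Perm.mul_apply, ← pow_add,
      Nat.sub_add_cancel hb.le, pow_upperCount]
  intro a ha b hb h
  rcases lt_trichotomy a b with hab | hab | hab
  · exact (key a b hab hb h).elim
  · exact hab
  · exact (key b a hab ha h.symm).elim

theorem sum_above [Fintype D] (g : D → ZMod 2) :
    ∑ d, bit (π.above d) * g d =
      ∑ i, ∑ m ∈ Finset.range (π.upperCount i), g ((G.φ ^ m) (π.upperStart i)) := by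
  classical
  have h1 : ∀ i, ∑ m ∈ Finset.range (π.upperCount i), g ((G.φ ^ m) (π.upperStart i)) =
      ∑ d, if π.IsAbove i d then g d else 0 := by
    intro i
    rw [← Finset.sum_image (f := g) (s := Finset.range (π.upperCount i))
      (g := fun m => (G.φ ^ m) (π.upperStart i)), ← Finset.sum_filter]
    · congr 1
      ext d
      simp [isAbove_iff]
    · simpa using π.pow_upperStart_injOn i
  simp only [h1]
  rw [Finset.sum_comm]
  refine Finset.sum_congr rfl fun d _ => ?_
  by_cases h : ∃ i, π.IsAbove i d
  · obtain ⟨i, hi⟩ := h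
    have : π.above d = true := by simpa [above] using ⟨i, hi⟩
    rw [this, Finset.sum_eq_single i]
    · simp [bit, hi]
    · exact fun j _ hj => if_neg fun h => hj (h.unique hi)
    · simp
  · have h' : π.above d = false := by simpa [above] using h
    push Not at h
    simp [h', bit, h]

/-- The upper side of the path is a walk from `t` to `s` in `G`. -/
theorem sum_above_coboundary [Fintype D] (x : G.Vertex → ZMod 2) :
    ∑ d, bit (π.above d) * (x (G.vertex d) + x (G.vertex (G.α d))) = x s + x t := by
  -- The sum telescopes along a face, because a dart ends at the vertex where its `φ`-successor
  -- starts.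
  have h1 : ∀ a m, ∑ r ∈ Finset.range m, (x (G.vertex ((G.φ ^ r) a)) +
      x (G.vertex (G.α ((G.φ ^ r) a)))) = x (G.vertex a) + x (G.vertex ((G.φ ^ m) a)) := by
    intro a m
    induction m with
    | zero => simp [CharTwo.add_self_eq_zero]
    | succ m ih =>
      rw [Finset.sum_range_succ, ih, pow_succ', Equiv.Perm.mul_apply, vertex_φ]
      linear_combination CharTwo.add_self_eq_zero (x (G.vertex ((G.φ ^ m) a)))
  rw [sum_above]
  simp only [h1, pow_upperCount]
  -- Consecutive arcs meet: the one at `f j` starts, and the one at `f (j+1)` stops, at the vertex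
  -- of `α (p j)`. After cancelling, only the two corners at `t` and `s` remain.
  rw [Finset.sum_add_distrib, Fin.sum_univ_castSucc, Fin.sum_univ_succ]
  simp only [upperStart_castSucc, upperStart_last, upperStop_zero, upperStop_succ, vertex_φ,
    vertex_startCorner, vertex_endCorner]
  linear_combination CharTwo.add_self_eq_zero (∑ j, x (G.vertex (G.α (π.p j))))

-- Both sides count the traversals by `C` of dual edges with ends attached from above: the left dart
-- by dart along `C`, the right along the upper side of π.
open Classical in
theorem sum_voltage (C : List D) (x : G.Vertex → ZMod 2)
    (hx : ∀ d, x (G.vertex d) + x (G.vertex (G.α d)) =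
      ((C.map G.edge).count (G.edge d) : ZMod 2)) :
    (C.map π.voltage).sum = x s + x t := by
  have := Fintype.ofFinite D
  rw [← π.sum_above_coboundary]
  simp only [hx]
  rw [G.sum_mul_count fun d => bit (π.above d)]
  rfl

/-- A closed walk of the dual graph is a cut-cycle if and only if it changes the sheet. -/
theorem isCutCycle_iff (c : G.Edge → ℝ) (u : G.Face) (C : List D) :
    G.IsCutCycle c s t u C ↔ (G.dual c).IsWalk u C u ∧ (C.map π.voltage).sum = 1 := by
  classical
  have := Fintype.ofFinite D
  refine and_congr_right fun hw => ⟨?_, fun hsum => ?_⟩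
  · rintro ⟨S, hS, hs, ht⟩
    have hS' : S = {v | (if v ∈ S then 1 else 0 : ZMod 2) = 1} := by ext v; simp
    rw [hS', isInterior_iff] at hS
    rw [π.sum_voltage C (fun v => if v ∈ S then 1 else 0) hS]
    simp [hs, ht]
  -- A closed walk enters and leaves every face equally often, so its parities are orthogonal to
  -- every function of faces.
  · obtain ⟨x, hx⟩ := G.exists_coboundary
      (fun e => ((C.map G.edge).count e : ZMod 2)) fun z => by
        rw [G.sum_mul_count fun d => z (G.face d), G.sum_of_isWalk_dual c z hw,
          CharTwo.add_self_eq_zero]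
    rw [π.sum_voltage C x hx] at hsum
    -- Adding the constant `x t` keeps the coboundary and puts `t` outside.
    refine ⟨{v | x v + x t = 1}, ?_, hsum, by simp [CharTwo.add_self_eq_zero]⟩
    rw [G.isInterior_iff C fun v => x v + x t]
    intro d
    rw [← hx d]
    linear_combination CharTwo.add_self_eq_zero (x t)

/-! ### Comparison of cut-cycles and separating paths -/

theorem exists_cutCycle_of_separatingPath (c : G.Edge → ℝ) (i : Fin (π.n + 1)) {r : ℝ}
    (hr : r ∈ π.separatingPathLengths c i) : r ∈ π.cutCycleCosts c i := by
  obtain ⟨ρ, ⟨⟨hw, -⟩, hj⟩, rfl⟩ := hr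
  obtain ⟨hC, hb⟩ := π.isWalk_proj c hw
  have hsupp := π.support_proj c (π.vertexF i) ρ
  rw [vertexF'_eq] at hC hb
  refine ⟨π.f i, ρ.map π.projDart, ⟨(π.isCutCycle_iff c _ _).2 ⟨hC, ?_⟩,
    WGraph.mem_support_self _ _ _, fun j hij hmem => ?_⟩, π.length_proj c ρ⟩
  · have : (1 : ZMod 2) = 0 + ((ρ.map π.projDart).map π.voltage).sum := hb
    rw [this, zero_add]
  · have hmem' : π.f j ∈ ((π.gluedGraph c).support (π.vertexF i) ρ).map fun w => (π.proj w).1 :=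
      hsupp ▸ hmem
    obtain ⟨w, hw, hwj⟩ := List.mem_map.1 hmem'
    have hwe := π.sheet_proj w
    rw [hwj] at hwe
    -- The two sheets over the face `f j` are exactly the excluded vertices `f j` and `f j'`.
    cases hb : (π.proj w).2
    · rw [hb] at hwe
      exact (hj j hij).1 (by rw [← hwe] at hw; exact hw)
    · rw [hb, ← vertexF'_eq] at hwe
      exact (hj j hij).2 (by rw [hwe]; exact hw)

theorem exists_separatingPath_of_cutCycle (c : G.Edge → ℝ) (hc : ∀ e, 0 ≤ c e)
    (i : Fin (π.n + 1)) {r : ℝ} (hr : r ∈ π.cutCycleCosts c i) :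
    ∃ r' ∈ π.separatingPathLengths c i, r' ≤ r := by
  obtain ⟨u, C, ⟨hcut, hi, hj⟩, rfl⟩ := hr
  obtain ⟨hw, hsum⟩ := (π.isCutCycle_iff c u C).1 hcut
  -- The cycle is rotated to start at `f i`; neither its total voltage nor its cost changes.
  obtain ⟨C₁, C₂, rfl, h₁, h₂⟩ := hw.exists_append _ hi
  have hw' : (G.dual c).IsWalk (π.f i) (C₂ ++ C₁) (π.f i) :=
    (WGraph.isWalk_append _).2 ⟨u, h₂, h₁⟩
  obtain ⟨ρ, b, hρ, hb, hl, hs⟩ := π.exists_lift c hw' false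
  have hb' : b = true := bit_injective (by
    rw [hb]
    simp only [List.map_append, List.sum_append] at hsum ⊢
    rw [add_comm (List.sum _), hsum]
    rfl)
  rw [hb', ← vertexF'_eq] at hρ
  have hsub : ∀ f ∈ (G.dual c).support (π.f i) (C₂ ++ C₁),
      f ∈ (G.dual c).support u (C₁ ++ C₂) := by
    intro f hf
    rw [WGraph.support_append _ _ u, List.mem_append] at hf
    rcases hf with hf | hf
    · exact WGraph.support_subset_of_isWalk_append _ h₁ hf
    · rw [WGraph.support_append _ _ (π.f i)]
      exact List.mem_append_left _ (List.mem_of_mem_tail hf)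
  obtain ⟨ρ', hp, hsub', hl'⟩ := hρ.exists_isPath _ fun a => by
    rw [← len_projDart]; exact hc _
  refine ⟨_, ⟨ρ', ⟨hp, fun j hij => ⟨fun h => ?_, fun h => ?_⟩⟩, rfl⟩, ?_⟩
  · exact hj j hij (hsub _ (hs _ (hsub' h)))
  · rw [vertexF'_eq] at h
    exact hj j hij (hsub _ (hs _ (hsub' h)))
  · refine hl'.trans (hl.le.trans (le_of_eq ?_))
    rw [WGraph.length_append, WGraph.length_append, add_comm]

/-- Existence of both minima rests on this side, since cut-cycles may be arbitrarily long walks. -/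
theorem finite_separatingPathLengths (c : G.Edge → ℝ) (i : Fin (π.n + 1)) :
    (π.separatingPathLengths c i).Finite := by
  have := π.finite_gluedVertex
  refine ((WGraph.finite_setOf_support_nodup (π.gluedGraph c) (π.vertexF i)).image
    (π.gluedGraph c).length).subset ?_
  rintro _ ⟨ρ, hρ, rfl⟩
  exact ⟨ρ, hρ.1.2, rfl⟩

end DualPath

end PlanarMap

/-- Either there are no `f i`-cut-cycles and no `f i`-separating paths, or both minima exist and
they are equal. -/
theorem mainTheorem6 {D : Type*} [Finite D] (G : PlanarMap D) (c : G.Edge → ℝ)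
    (hc : ∀ e, 0 ≤ c e) (s t : G.Vertex) (hst : s ≠ t) (π : G.DualPath s t)
    (i : Fin (π.n + 1)) :
    (π.cutCycleCosts c i = ∅ ∧ π.separatingPathLengths c i = ∅) ∨
      ∃ m : ℝ, IsLeast (π.cutCycleCosts c i) m ∧ IsLeast (π.separatingPathLengths c i) m := by
  rcases (π.separatingPathLengths c i).eq_empty_or_nonempty with h | h
  · refine Or.inl ⟨Set.eq_empty_iff_forall_notMem.2 fun r hr => ?_, h⟩
    obtain ⟨r', hr', -⟩ := π.exists_separatingPath_of_cutCycle c hc i hr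
    exact (Set.eq_empty_iff_forall_notMem.1 h) r' hr'
  · obtain ⟨m, hm, hmin⟩ := Set.exists_min_image _ id (π.finite_separatingPathLengths c i) h
    refine Or.inr ⟨m, ⟨π.exists_cutCycle_of_separatingPath c i hm, fun r hr => ?_⟩, hm, hmin⟩
    obtain ⟨r', hr', hle⟩ := π.exists_separatingPath_of_cutCycle c hc i hr
    exact (hmin r' hr').trans hle
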